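/- Let $n\ge 0$ and let $h\in\mathbb{R}[x]=\mathbb{R}[x_1,\dots,x_n]$ be a finite product (possibly empty, in which case $h=1$) of irreducible polynomials $p$, each of which is real, i.e. there are $u,v\in\mathbb{R}^n$ with $p(u)<0<p(v)$. Let $A=\mathbb{R}[x,h^{-1}]$ be the localization of $\mathbb{R}[x]$ at the powers of $h$. Let $\Sigma A^2$ be the set of all finite sums of squares of elements of $A$, let $\widehat A$ be the set of unital $\mathbb{R}$-algebra homomorphisms $\chi\colon A\to\mathbb{R}$ with the topology of pointwise convergence, and let $A_+=\{a\in A:\chi(a)\ge 0\text{ for all }\chi\in\widehat A\}$. (a) $\Sigma A^2$ is closed in the finest locally convex topology of the real vector space $A$. (b) If $n\ge 2$, then $A$ does not have the moment property: not every linear functional $L\colon A\to\mathbb{R}$ with $L(f^2)\ge 0$ for all $f\in A$ is of the form $L(f)=\int_{\widehat A}\chi(f)\,d\mu(\chi)$ $(f\in A)$ for a (positive) Radon measure $\mu$ on $\widehat A$ with respect to which all functions $\chi\mapsto\chi(f)$, $f\in A$, are integrable. Moreover, for all indices $i\ne j$ the Motzkin polynomial $x_i^4x_j^2+x_i^2x_j^4-3x_i^2x_j^2+1$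 lies in $A_+$ but not in $\Sigma A^2$. -/

import Mathlib

open scoped Topology

noncomputable section

/-- A real irreducible polynomial: irreducible over `ℝ`, and strictly negative at some point
of `ℝⁿ` and strictly positive at some other point. -/
def IsRealIrreducible {n : ℕ} (p : MvPolynomial (Fin n) ℝ) : Prop :=
  Irreducible p ∧
    ∃ u v : Fin n → ℝ, MvPolynomial.eval u p < 0 ∧ 0 < MvPolynomial.eval v p

/-- The algebra of fractions `ℝ[x₁, …, xₙ, h⁻¹]`. -/
abbrev FractionAlgebra {n : ℕ} (h : MvPolynomial (Fin n) ℝ) : Type :=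
  Localization.Away h

/-- The finest locally convex topology on a real vector space: the infimum (in Mathlib's order
`t ≤ s` means that `t` is finer than `s`) of all locally convex vector space topologies. -/
abbrev finestLocallyConvexTopology (E : Type*) [AddCommGroup E] [Module ℝ E] :
    TopologicalSpace E :=
  sInf {t : TopologicalSpace E |
    @IsTopologicalAddGroup E t _ ∧ @ContinuousSMul ℝ E _ _ t ∧ @LocallyConvexSpace ℝ E _ _ _ _ t}

/-- The sos cone: all finite sums of squares. -/
def sosCone (B : Type*) [CommRing B] : Set B :=
  {b | IsSumSq b}

/-- The set of characters (unital algebra homomorphisms to `ℝ`) of a real algebra. -/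
def RealCharacter (B : Type*) [CommRing B] [Algebra ℝ B] : Type _ :=
  B →ₐ[ℝ] ℝ

namespace RealCharacter

variable {B : Type*} [CommRing B] [Algebra ℝ B]

instance : CoeFun (RealCharacter B) (fun _ => B → ℝ) :=
  ⟨fun χ => (show B →ₐ[ℝ] ℝ from χ)⟩

/-- The topology of pointwise convergence. When `B` is generated by `b₁, …, b_d`, it is the one
induced by the embedding `χ ↦ (χ b₁, …, χ b_d)` into `ℝ^d`. -/
instance : TopologicalSpace (RealCharacter B) :=
  TopologicalSpace.induced (fun χ : RealCharacter B => fun b : B => χ b) inferInstance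

instance : MeasurableSpace (RealCharacter B) := borel _

instance : BorelSpace (RealCharacter B) := ⟨rfl⟩

end RealCharacter

/-- The positive semidefinite elements: those that are nonnegative at every character. -/
def psdCone (B : Type*) [CommRing B] [Algebra ℝ B] : Set B :=
  {b | ∀ χ : RealCharacter B, 0 ≤ χ b}

/-- `L` is integration against a positive Radon measure on the space of characters. -/
def IsMomentFunctional {B : Type*} [CommRing B] [Algebra ℝ B] (L : B →ₗ[ℝ] ℝ) : Prop :=
  ∃ μ : MeasureTheory.Measure (RealCharacter B),
    MeasureTheory.IsFiniteMeasureOnCompacts μ ∧ μ.InnerRegular ∧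
      ∀ f : B, MeasureTheory.Integrable (fun χ : RealCharacter B => χ f) μ ∧
        L f = ∫ χ : RealCharacter B, χ f ∂μ

/-- The moment property: every linear functional that is nonnegative on squares is a moment
functional. -/
def HasMomentProperty (B : Type*) [CommRing B] [Algebra ℝ B] : Prop :=
  ∀ L : B →ₗ[ℝ] ℝ, (∀ f : B, 0 ≤ L (f ^ 2)) → IsMomentFunctional L

/-- The Motzkin polynomial `xᵢ⁴ xⱼ² + xᵢ² xⱼ⁴ - 3 xᵢ² xⱼ² + 1` in two of the variables. -/
def motzkinPolynomial {n : ℕ} (i j : Fin n) : MvPolynomial (Fin n) ℝ :=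
  MvPolynomial.X i ^ 4 * MvPolynomial.X j ^ 2 + MvPolynomial.X i ^ 2 * MvPolynomial.X j ^ 4
    - 3 * MvPolynomial.X i ^ 2 * MvPolynomial.X j ^ 2 + 1

end

/-!
A polynomial that vanishes at the real zeros of a real irreducible polynomial `p` is divisible by
`p`. Otherwise Gauss's lemma, applied along lines from `u` to `v` where `p(u) < 0 < p(v)`, gives a
nonzero polynomial `d` in the ideal of the sheared polynomials that is constant along these lines;
as every line close to the one through `u` and `v` meets the zeros of `p`, `d` vanishes near `u`.
Hence if `p²` divides a sum of squares then `p` divides every term, and the same holds for products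
of such `p`. Denominators in sums of squares of `A` can therefore be cancelled.

Since leading forms of squares of real polynomials do not cancel, the terms of a sum of squares
have bounded degree. So, after clearing denominators, the sums of squares in a finite-dimensional
subspace of `A` come from a finite-dimensional space `W`. The cone generated by the squares of `W`
is the image of `M ↦ Mᵀ M` followed by a linear map, which is homogeneous with trivial zero set,
hence has closed range. As `A` has countable dimension, a set with closed finite-dimensional traces
is closed in the finest locally convex topology.

If a positive semidefinite element lies outside a closed sos cone, a separating functional is not
given by a measure. The Motzkin polynomial is such an element: a polynomial `F` with `F² ≤ M`
pointwise has a nonnegative coefficient of `x²y²` in `F²`, whereas that of `M` is `-3`.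
-/

section FiniteDimensionalTraces

open Pointwise

variable {E : Type*} [AddCommGroup E] [Module ℝ E] [TopologicalSpace E]
  [IsTopologicalAddGroup E] [ContinuousSMul ℝ E]

theorem exists_pos_disjoint_add_segment {K D : Set E} (hK : IsCompact K) (hD : IsClosed D)
    (hKD : Disjoint K D) (v : E) :
    ∃ δ > 0, Disjoint (K + (fun t : ℝ => t • v) '' Set.Icc (-δ) δ) D := by
  obtain ⟨V, hV, hKV⟩ :=
    compact_open_separated_add_right hK hD.isOpen_compl hKD.subset_compl_right
  have hsmul : Filter.Tendsto (fun t : ℝ => t • v) (𝓝 0) (𝓝 0) := by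
    simpa using (continuous_id.smul continuous_const).tendsto (f := fun t : ℝ => t • v) 0
  obtain ⟨δ, hδ, hball⟩ := Metric.nhds_basis_closedBall.mem_iff.1 (hsmul hV)
  refine ⟨δ, hδ, Set.disjoint_left.2 ?_⟩
  rw [Real.closedBall_eq_Icc, zero_sub, zero_add] at hball
  exact (Set.add_subset_add_left (Set.image_subset_iff.2 hball)).trans hKV

theorem exists_pos_forall_add_sum_notMem {C : Set E}
    (hC : ∀ F : Submodule ℝ E, FiniteDimensional ℝ F → IsClosed (C ∩ F)) {x : E} (hx : x ∉ C)
    (e : ℕ → E) :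
    ∃ ε : ℕ → ℝ, (∀ k, 0 < ε k) ∧ ∀ (m : ℕ) (c : ℕ → ℝ), (∀ k, |c k| ≤ ε k) →
      x + ∑ k ∈ Finset.range m, c k • e k ∉ C := by
  -- Compact boxes around `x` grow by one segment at a time: each lies in a finite-dimensional
  -- subspace, where `C` is closed, so there is room for the next segment.
  let segment (δ : ℝ) (v : E) : Set E := (fun t : ℝ => t • v) '' Set.Icc (-δ) δ
  let Good (K : Set E) : Prop :=
    IsCompact K ∧ Disjoint K C ∧ ∃ F : Submodule ℝ E, FiniteDimensional ℝ F ∧ K ⊆ F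
  have extend (K : Set E) (hK : Good K) (v : E) : ∃ δ > 0, Good (K + segment δ v) := by
    obtain ⟨hcomp, hdisj, F, hF, hKF⟩ := hK
    let F' := F ⊔ Submodule.span ℝ {v}
    obtain ⟨δ, hδ, h⟩ := exists_pos_disjoint_add_segment hcomp
      (hC F' inferInstance) (hdisj.mono_right Set.inter_subset_left) v
    have hsub : K + segment δ v ⊆ F' := by
      rintro _ ⟨y, hy, _, ⟨t, -, rfl⟩, rfl⟩
      exact add_mem (Submodule.mem_sup_left (hKF hy)) (F'.smul_mem t
        (Submodule.mem_sup_right (Submodule.mem_span_singleton_self v)))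
    refine ⟨δ, hδ, hcomp.add (isCompact_Icc.image (by fun_prop)), ?_, F', inferInstance, hsub⟩
    exact Set.disjoint_left.2 fun y hy hyC => Set.disjoint_left.1 h hy ⟨hyC, hsub hy⟩
  choose! δ hδ hgood using extend
  let K (m : ℕ) : Set E := Nat.rec {x} (fun k K => K + segment (δ K (e k)) (e k)) m
  have hK (m : ℕ) : Good (K m) := by
    induction m with
    | zero =>
      exact ⟨isCompact_singleton, Set.disjoint_singleton_left.2 hx, Submodule.span ℝ {x},
        inferInstance, Submodule.subset_span⟩
    | succ m ih => exact hgood _ ih _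
  refine ⟨fun k => δ (K k) (e k), fun k => hδ _ (hK k) _, fun m c hc => ?_⟩
  suffices x + ∑ k ∈ Finset.range m, c k • e k ∈ K m from
    Set.disjoint_left.1 (hK m).2.1 this
  induction m with
  | zero => simp [K]
  | succ m ih =>
    rw [Finset.sum_range_succ, ← add_assoc]
    exact Set.add_mem_add ih ⟨c m, abs_le.1 (hc m), rfl⟩

end FiniteDimensionalTraces

namespace finestLocallyConvexTopology

theorem isTopologicalAddGroup (E : Type*) [AddCommGroup E] [Module ℝ E] :
    @IsTopologicalAddGroup E (finestLocallyConvexTopology E) _ :=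
  topologicalAddGroup_sInf fun _ h => h.1

theorem continuousSMul (E : Type*) [AddCommGroup E] [Module ℝ E] :
    @ContinuousSMul ℝ E _ _ (finestLocallyConvexTopology E) :=
  continuousSMul_sInf fun _ h => h.2.1

theorem locallyConvexSpace (E : Type*) [AddCommGroup E] [Module ℝ E] :
    @LocallyConvexSpace ℝ E _ _ _ _ (finestLocallyConvexTopology E) :=
  LocallyConvexSpace.sInf fun _ h => h.2.2

variable {E : Type*} [AddCommGroup E] [Module ℝ E]

theorem continuous_linearMap {F : Type*} [AddCommGroup F] [Module ℝ F] [t : TopologicalSpace F]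
    [IsTopologicalAddGroup F] [ContinuousSMul ℝ F] [LocallyConvexSpace ℝ F] (f : E →ₗ[ℝ] F) :
    @Continuous E F (finestLocallyConvexTopology E) t f :=
  continuous_iff_le_induced.2 <| sInf_le
    ⟨topologicalAddGroup_induced f, continuousSMul_induced f, .induced f⟩

theorem t2Space (E : Type*) [AddCommGroup E] [Module ℝ E] :
    @T2Space E (finestLocallyConvexTopology E) := by
  let b := Module.Basis.ofVectorSpace ℝ E
  let coords : E →ₗ[ℝ] (Module.Basis.ofVectorSpaceIndex ℝ E → ℝ) :=
    Finsupp.lcoeFun ∘ₗ b.repr.toLinearMap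
  exact @T2Space.of_injective_continuous _ _ (finestLocallyConvexTopology E) _ _ coords
    (DFunLike.coe_injective.comp b.repr.injective) (continuous_linearMap coords)

theorem eventually_seminorm_lt (p : Seminorm ℝ E) {r : ℝ} (hr : 0 < r) :
    ∀ᶠ y in @nhds E (finestLocallyConvexTopology E) 0, p y < r := by
  let G : SeminormedAddCommGroup E := p.toAddGroupSeminorm.toSeminormedAddCommGroup
  let N : NormedSpace ℝ E := ⟨fun a y => (map_smul_eq_mul p a y).le⟩
  let t : TopologicalSpace E := G.toPseudoMetricSpace.toUniformSpace.toTopologicalSpace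
  have ht : finestLocallyConvexTopology E ≤ t :=
    sInf_le ⟨inferInstance, inferInstance, inferInstance⟩
  refine nhds_mono ht ?_
  filter_upwards [Metric.ball_mem_nhds (0 : E) hr] with y hy
  exact mem_ball_zero_iff.1 hy

theorem eventually_forall_abs_le {ι : Type*} (f : E →ₗ[ℝ] (ι →₀ ℝ)) {ε : ι → ℝ}
    (hε : ∀ k, 0 < ε k) :
    ∀ᶠ y in @nhds E (finestLocallyConvexTopology E) 0, ∀ k, |f y k| ≤ ε k := by
  let q (k : ι) : Seminorm ℝ E :=
    (normSeminorm ℝ ℝ).comp ((ε k)⁻¹ • (Finsupp.lapply k ∘ₗ f))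
  have hq (k : ι) (y : E) : q k y = (ε k)⁻¹ * |f y k| := by
    simp [q, abs_of_pos (hε k)]
  have hbdd : BddAbove (Set.range q) := by
    refine Seminorm.bddAbove_range_iff.2 fun y => ?_
    refine ((f y).support.finite_toSet.image fun k => q k y).bddAbove.insert 0 |>.mono ?_
    rintro _ ⟨k, rfl⟩
    by_cases hk : k ∈ (f y).support
    · exact .inr ⟨k, hk, rfl⟩
    · exact .inl (by simp [hq, Finsupp.notMem_support_iff.1 hk])
  filter_upwards [eventually_seminorm_lt (⨆ k, q k) one_pos] with y hy k
  have hle : q k y ≤ (⨆ k, q k) y := le_ciSup hbdd k y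
  rw [hq] at hle
  simpa using (inv_mul_le_iff₀ (hε k)).1 (hle.trans hy.le)

theorem isClosed_of_forall_inter {e : ℕ → E} (he : Submodule.span ℝ (Set.range e) = ⊤)
    {C : Set E} (hC : ∀ F : Submodule ℝ E, FiniteDimensional ℝ F →
      IsClosed[finestLocallyConvexTopology E] (C ∩ F)) :
    IsClosed[finestLocallyConvexTopology E] C := by
  let : TopologicalSpace E := finestLocallyConvexTopology E
  have := isTopologicalAddGroup E
  have := continuousSMul E
  obtain ⟨f, hf⟩ := (Finsupp.linearCombination ℝ e).exists_rightInverse_of_surjective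
    (by rw [Finsupp.range_linearCombination, he])
  rw [← isOpen_compl_iff, isOpen_iff_mem_nhds]
  intro x hx
  obtain ⟨ε, hε, hbox⟩ := exists_pos_forall_add_sum_notMem hC hx e
  have hsub : Filter.Tendsto (· - x) (𝓝 x) (𝓝 0) := by
    simpa using (continuous_id.sub continuous_const).tendsto (f := (· - x)) x
  filter_upwards [hsub.eventually (eventually_forall_abs_le f hε)] with y hy
  obtain ⟨m, hm⟩ := (f (y - x)).support.exists_nat_subset_range
  have hsum : ∑ k ∈ Finset.range m, f (y - x) k • e k = y - x := by
    rw [← Finsupp.sum_of_support_subset _ hm (fun k r => r • e k) (by simp),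
      ← Finsupp.linearCombination_apply]
    exact LinearMap.congr_fun hf (y - x)
  have hmem := hbox m (f (y - x)) hy
  rwa [hsum, add_sub_cancel] at hmem

end finestLocallyConvexTopology

section SumsOfSquares

theorem isSumSq_map {R S F : Type*} [NonUnitalNonAssocSemiring R] [NonUnitalNonAssocSemiring S]
    [FunLike F R S] [NonUnitalRingHomClass F R S] (f : F) {s : R} (hs : IsSumSq s) :
    IsSumSq (f s) := by
  induction hs with
  | zero => simp
  | sq_add a _ ih => simpa using ih.sq_add (f a)

theorem isSumSq_smul {B : Type*} [Semiring B] [Algebra ℝ B] {r : ℝ} (hr : 0 ≤ r) {s : B}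
    (hs : IsSumSq s) : IsSumSq (r • s) := by
  induction hs with
  | zero => simp
  | sq_add a _ ih =>
    rw [smul_add, ← Real.mul_self_sqrt hr, ← smul_mul_smul_comm, Real.mul_self_sqrt hr]
    exact ih.sq_add _

theorem eq_zero_of_sum_mul_self_eq_zero {R ι : Type*} [Ring R] [IsFormallyReal R]
    [Fintype ι] {a : ι → R} (h : ∑ i, a i * a i = 0) (i : ι) : a i = 0 := by
  classical
  rw [← Finset.add_sum_erase _ _ (Finset.mem_univ i)] at h
  have hsq : a i * a i = 0 :=
    IsFormallyReal.eq_zero_of_add_right (.mul_self _) (.sum_mul_self _ a) h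
  rwa [← sq, pow_eq_zero_iff two_ne_zero] at hsq

end SumsOfSquares

section GramMatrices

open Matrix

variable {ι B : Type*} [Fintype ι] [Ring B] [Algebra ℝ B] (w : ι → B)

/-- The element `∑ᵢⱼ Gᵢⱼ wᵢ wⱼ` with Gram matrix `G` with respect to the family `w`. -/
def gramElement (G : Matrix ι ι ℝ) : B :=
  ∑ i, ∑ j, G i j • (w i * w j)

theorem gramElement_add (G H : Matrix ι ι ℝ) :
    gramElement w (G + H) = gramElement w G + gramElement w H := by
  simp [gramElement, add_smul, Finset.sum_add_distrib]

theorem gramElement_vecMulVec (u v : ι → ℝ) :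
    gramElement w (vecMulVec u v) = (∑ i, u i • w i) * ∑ j, v j • w j := by
  simp only [gramElement, vecMulVec_apply, Finset.sum_mul_sum, smul_mul_smul_comm]

theorem gramElement_transpose_mul_self (M : Matrix ι ι ℝ) :
    gramElement w (Mᵀ * M) = ∑ c, (∑ i, M c i • w i) * ∑ i, M c i • w i := by
  simp only [← gramElement_vecMulVec, gramElement, mul_apply, transpose_apply,
    vecMulVec_apply, Finset.sum_smul]
  rw [Finset.sum_comm_cycle]

theorem gramElement_transpose_mul_self_smul (r : ℝ) (M : Matrix ι ι ℝ) :
    gramElement w ((r • M)ᵀ * (r • M)) = r ^ 2 • gramElement w (Mᵀ * M) := by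
  simp [gramElement, Finset.smul_sum, smul_smul, sq, mul_assoc]

theorem continuous_gramElement_transpose_mul_self [TopologicalSpace B] [ContinuousAdd B]
    [ContinuousSMul ℝ B] :
    Continuous fun M : Matrix ι ι ℝ => gramElement w (Mᵀ * M) := by
  unfold gramElement
  fun_prop

theorem eq_zero_of_gramElement_transpose_mul_self_eq_zero [IsFormallyReal B]
    {w : ι → B} (hw : LinearIndependent ℝ w) {M : Matrix ι ι ℝ}
    (h : gramElement w (Mᵀ * M) = 0) : M = 0 := by
  rw [gramElement_transpose_mul_self] at h
  ext c i
  exact Fintype.linearIndependent_iff.1 hw (M c) (eq_zero_of_sum_mul_self_eq_zero h c) i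

open scoped MatrixOrder in
theorem exists_transpose_mul_self_eq {G : Matrix ι ι ℝ} (hG : G.PosSemidef) :
    ∃ M : Matrix ι ι ℝ, Mᵀ * M = G := by
  classical
  obtain ⟨M, hM⟩ := CStarAlgebra.nonneg_iff_eq_star_mul_self.mp hG.nonneg
  exact ⟨M, by rw [hM, star_eq_conjTranspose, conjTranspose_eq_transpose_of_trivial]⟩

theorem closure_mul_self_span_eq_range_gramElement :
    (AddSubmonoid.closure ((fun a => a * a) '' (Submodule.span ℝ (Set.range w) : Set B)) : Set B) =
      Set.range fun M : Matrix ι ι ℝ => gramElement w (Mᵀ * M) := by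
  refine Set.Subset.antisymm (fun s hs => ?_) ?_
  · induction hs using AddSubmonoid.closure_induction_left with
    | zero => exact ⟨0, by simp [gramElement]⟩
    | add_left _ ha s _ ih =>
      obtain ⟨a, ha, rfl⟩ := ha
      obtain ⟨v, rfl⟩ := (Submodule.mem_span_range_iff_exists_fun ℝ).1 ha
      obtain ⟨M, rfl⟩ := ih
      have hpsd : (vecMulVec v v + Mᵀ * M).PosSemidef := by
        simpa using (posSemidef_vecMulVec_self_star v).add
          (posSemidef_conjTranspose_mul_self M)
      obtain ⟨N, hN⟩ := exists_transpose_mul_self_eq hpsd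
      exact ⟨N, by simp only [hN, gramElement_add, gramElement_vecMulVec]⟩
  · rintro _ ⟨M, rfl⟩
    simp only [gramElement_transpose_mul_self]
    exact sum_mem fun c _ => AddSubmonoid.subset_closure ⟨_, sum_mem fun i _ =>
      Submodule.smul_mem _ _ (Submodule.subset_span ⟨i, rfl⟩), rfl⟩

end GramMatrices

theorem isClosed_range_of_map_smul_eq_pow_smul {E F : Type*} [NormedAddCommGroup E]
    [NormedSpace ℝ E] [FiniteDimensional ℝ E] [AddCommGroup F] [Module ℝ F] [TopologicalSpace F]
    [T2Space F] [ContinuousSMul ℝ F] {f : E → F} (hf : Continuous f) {d : ℕ} (hd : d ≠ 0)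
    (hsmul : ∀ (r : ℝ) x, f (r • x) = r ^ d • f x) (hzero : ∀ x, f x = 0 → x = 0) :
    IsClosed (Set.range f) := by
  -- The range is the projection of a closed subset of `F` times a compact sphere: `y` lies in it
  -- if and only if `f x = r ^ d • y` for some `(r, x)` of norm `1`, where `hzero` excludes `r = 0`.
  have hclosed : IsClosed {p : F × Metric.sphere (0 : ℝ × E) 1 |
      f p.2.1.2 = p.2.1.1 ^ d • p.1} :=
    isClosed_eq (by fun_prop) (by fun_prop)
  convert isClosedMap_fst_of_compactSpace _ hclosed
  ext y
  constructor
  · rintro ⟨x, rfl⟩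
    have hx : ‖((1 : ℝ), x)‖ ≠ 0 := norm_ne_zero_iff.2 (by simp)
    refine ⟨(f x, ⟨‖((1 : ℝ), x)‖⁻¹ • (1, x), ?_⟩), ?_, rfl⟩
    · rw [mem_sphere_zero_iff_norm, norm_smul, norm_inv, norm_norm, inv_mul_cancel₀ hx]
    · simp [hsmul]
  · rintro ⟨⟨y, ⟨r, x⟩, hrx⟩, heq : f x = r ^ d • y, rfl⟩
    have hr : r ≠ 0 := by
      rintro rfl
      have hx : x = 0 := hzero x (by simpa [hd] using heq)
      simp [hx] at hrx
    refine ⟨r⁻¹ • x, ?_⟩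
    rw [hsmul, heq, smul_smul, ← mul_pow, inv_mul_cancel₀ hr, one_pow, one_smul]

theorem isClosed_closure_mul_self {B : Type*} [Ring B] [Algebra ℝ B] [IsFormallyReal B]
    [TopologicalSpace B] [ContinuousAdd B] [ContinuousSMul ℝ B] [T2Space B] (W : Submodule ℝ B)
    [FiniteDimensional ℝ W] :
    IsClosed (AddSubmonoid.closure ((fun a => a * a) '' (W : Set B)) : Set B) := by
  let b := Module.finBasis ℝ W
  let w : Fin (Module.finrank ℝ W) → B := fun i => b i
  have hw : LinearIndependent ℝ w := b.linearIndependent.map' W.subtype W.ker_subtype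
  have hspan : Submodule.span ℝ (Set.range w) = W := by
    rw [show w = W.subtype ∘ b from rfl, Set.range_comp, Submodule.span_image, b.span_eq,
      Submodule.map_top, Submodule.range_subtype]
  rw [← hspan, closure_mul_self_span_eq_range_gramElement]
  exact isClosed_range_of_map_smul_eq_pow_smul
    (E := Fin (Module.finrank ℝ W) → Fin (Module.finrank ℝ W) → ℝ)
    (continuous_gramElement_transpose_mul_self w) two_ne_zero
    (gramElement_transpose_mul_self_smul w)
    fun _ => eq_zero_of_gramElement_transpose_mul_self_eq_zero hw

/-- Stability of sums of squares: the terms of all sums of squares lying in a given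
finite-dimensional subspace lie in a common finite-dimensional subspace. -/
def HasStableSumsOfSquares (B : Type*) [CommRing B] [Algebra ℝ B] : Prop :=
  ∀ F : Submodule ℝ B, FiniteDimensional ℝ F → ∃ W : Submodule ℝ B, FiniteDimensional ℝ W ∧
    ∀ a s : B, IsSumSq s → a * a + s ∈ F → a ∈ W

theorem HasStableSumsOfSquares.isClosed_sosCone {B : Type*} [CommRing B] [Algebra ℝ B]
    [IsFormallyReal B] (hB : HasStableSumsOfSquares B) {e : ℕ → B}
    (he : Submodule.span ℝ (Set.range e) = ⊤) :
    IsClosed[finestLocallyConvexTopology B] (sosCone B) := by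
  let : TopologicalSpace B := finestLocallyConvexTopology B
  have := finestLocallyConvexTopology.isTopologicalAddGroup B
  have := finestLocallyConvexTopology.continuousSMul B
  have := finestLocallyConvexTopology.t2Space B
  refine finestLocallyConvexTopology.isClosed_of_forall_inter he fun F hF => ?_
  obtain ⟨W, hW, hFW⟩ := hB F hF
  let S := AddSubmonoid.closure ((fun a => a * a) '' (W : Set B))
  have hle : S ≤ AddSubmonoid.sumSq B :=
    AddSubmonoid.closure_le.2 (Set.image_subset_iff.2 fun a _ => IsSumSq.mul_self a)
  have hmem {s t : B} (hs : IsSumSq s) (ht : IsSumSq t) (h : t + s ∈ F) : s ∈ S := by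
    induction hs generalizing t with
    | zero => exact S.zero_mem
    | sq_add a hs ih =>
      refine S.add_mem (AddSubmonoid.subset_closure ⟨a, hFW a _ (ht.add hs) ?_, rfl⟩)
        (ih (ht.add (.mul_self a)) (by rwa [add_assoc]))
      rwa [add_left_comm]
  have htrace : sosCone B ∩ F = (S : Set B) ∩ F := by
    ext s
    refine and_congr_left fun hsF => ⟨fun hs => hmem hs .zero ?_, fun hs => hle hs⟩
    rwa [zero_add]
  rw [htrace]
  exact (isClosed_closure_mul_self W).inter F.closed_of_finiteDimensional

section Univariate

open Polynomial

theorem coeff_nonneg_of_eval_nonneg {P : ℝ[X]} (h : ∀ t, 0 ≤ P.eval t) {k : ℕ}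
    (hk : P.natDegree ≤ k) : 0 ≤ P.coeff k := by
  rcases hk.lt_or_eq with hlt | rfl
  · rw [coeff_eq_zero_of_natDegree_lt hlt]
  by_contra! hneg
  rcases P.natDegree.eq_zero_or_pos with h0 | hpos
  · have h1 := h 0
    rw [← coeff_zero_eq_eval_zero, ← h0] at h1
    exact hneg.not_ge h1
  · obtain ⟨t, ht⟩ := ((P.tendsto_atBot_of_leadingCoeff_nonpos
      (natDegree_pos_iff_degree_pos.1 hpos) hneg.le).eventually_lt_atBot 0).exists
    exact ht.not_ge (h t)

variable {P Q : ℝ[X]} {d : ℕ}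

theorem natDegree_le_of_eval_sq_le (h : ∀ t, Q.eval t ^ 2 ≤ P.eval t)
    (hP : P.natDegree ≤ 2 * d) : Q.natDegree ≤ d := by
  by_contra! hlt
  have hcoeff : 0 ≤ (P - Q ^ 2).coeff (2 * Q.natDegree) :=
    coeff_nonneg_of_eval_nonneg (by simpa using h)
      ((natDegree_sub_le_of_le hP (natDegree_pow_le (p := Q) (n := 2))).trans (by omega))
  rw [coeff_sub, coeff_pow_of_natDegree_le le_rfl, coeff_eq_zero_of_natDegree_lt (by omega),
    zero_sub, neg_nonneg] at hcoeff
  have hlead : Q.leadingCoeff = 0 := pow_eq_zero_iff two_ne_zero |>.1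
    (hcoeff.antisymm (sq_nonneg _))
  simp [leadingCoeff_eq_zero.1 hlead] at hlt

theorem coeff_sq_le_of_eval_sq_le (h : ∀ t, Q.eval t ^ 2 ≤ P.eval t)
    (hP : P.natDegree ≤ 2 * d) : Q.coeff d ^ 2 ≤ P.coeff (2 * d) := by
  have hQ := natDegree_le_of_eval_sq_le h hP
  have hcoeff : 0 ≤ (P - Q ^ 2).coeff (2 * d) :=
    coeff_nonneg_of_eval_nonneg (by simpa using h)
      ((natDegree_sub_le_of_le hP (natDegree_pow_le_of_le 2 hQ)).trans_eq (max_self _))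
  rwa [coeff_sub, coeff_pow_of_natDegree_le hQ, sub_nonneg] at hcoeff

end Univariate

section RestrictToLine

variable {σ R A : Type*} [CommRing R] [CommRing A] [Algebra R A]

/-- The restriction `q ↦ q(y + t w)` of polynomials to the line through `y` in direction `w`,
with the coordinates of `y` and `w` in an arbitrary algebra of coefficients. -/
noncomputable def restrictToLine (y w : σ → A) : MvPolynomial σ R →ₐ[R] Polynomial A :=
  MvPolynomial.aeval fun i => Polynomial.C (y i) + Polynomial.C (w i) * Polynomial.X

theorem eval₂_restrictToLine {S : Type*} [CommRing S] [Algebra R S] (y w : σ → A) (φ : A →ₐ[R] S)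
    (t : S) (q : MvPolynomial σ R) :
    (restrictToLine y w q).eval₂ φ t = MvPolynomial.aeval (fun i => φ (y i) + φ (w i) * t) q := by
  suffices h : (Polynomial.eval₂AlgHom φ t fun _ => .all _ _).comp (restrictToLine y w) =
      MvPolynomial.aeval fun i => φ (y i) + φ (w i) * t from DFunLike.congr_fun h q
  ext i
  simp [restrictToLine]

theorem eval_restrictToLine (y w : σ → A) (t : A) (q : MvPolynomial σ R) :
    (restrictToLine y w q).eval t = MvPolynomial.aeval (fun i => y i + w i * t) q :=
  eval₂_restrictToLine y w (AlgHom.id R A) t q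

theorem coeff_restrictToLine_zero (w : σ → A) (q : MvPolynomial σ R) (k : ℕ) :
    (restrictToLine 0 w q).coeff k =
      MvPolynomial.aeval w (MvPolynomial.homogeneousComponent k q) := by
  induction q using MvPolynomial.induction_on' with
  | add p q hp hq => simp [hp, hq]
  | monomial d r =>
    have hline : restrictToLine 0 w (MvPolynomial.monomial d r) =
        Polynomial.C (MvPolynomial.aeval w (MvPolynomial.monomial d r)) *
          Polynomial.X ^ d.degree := by
      simp [restrictToLine, MvPolynomial.aeval_monomial, mul_pow, Finsupp.prod,
        Finset.prod_mul_distrib, Finset.prod_pow_eq_pow_sum, Finsupp.degree_apply, mul_assoc]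
    rw [hline, Polynomial.coeff_C_mul_X_pow,
      MvPolynomial.homogeneousComponent_of_mem (MvPolynomial.isHomogeneous_monomial r rfl)]
    split_ifs <;> simp

theorem natDegree_restrictToLine_zero_le (w : σ → A) (q : MvPolynomial σ R) :
    (restrictToLine 0 w q).natDegree ≤ q.totalDegree := by
  refine Polynomial.natDegree_le_iff_coeff_eq_zero.2 fun k hk => ?_
  rw [coeff_restrictToLine_zero, MvPolynomial.homogeneousComponent_eq_zero _ _ hk, map_zero]

end RestrictToLine

section RealPolynomials

open MvPolynomial

variable {σ : Type*}

theorem eval_nonneg_of_isSumSq {s : MvPolynomial σ ℝ} (hs : IsSumSq s) (x : σ → ℝ) :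
    0 ≤ eval x s :=
  (isSumSq_map (eval x) hs).nonneg

theorem eval_sq_le_eval_mul_self_add (q : MvPolynomial σ ℝ) {s : MvPolynomial σ ℝ}
    (hs : IsSumSq s) (x : σ → ℝ) : eval x q ^ 2 ≤ eval x (q * q + s) := by
  rw [map_add, map_mul, ← sq]
  exact le_add_of_nonneg_right (eval_nonneg_of_isSumSq hs x)

instance isFormallyReal_mvPolynomial : IsFormallyReal (MvPolynomial σ ℝ) :=
  .of_eq_zero_of_eq_zero_of_mul_self_add fun {s q} hs h => funext fun x => by
    have hle := eval_sq_le_eval_mul_self_add q hs x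
    rw [h, map_zero] at hle
    rw [map_zero, ← sq_nonpos_iff]
    exact hle

theorem totalDegree_le_of_eval_sq_le {q P : MvPolynomial σ ℝ}
    (h : ∀ x, eval x q ^ 2 ≤ eval x P) {d : ℕ} (hP : P.totalDegree ≤ 2 * d) :
    q.totalDegree ≤ d := by
  refine Finset.sup_le fun m hm => ?_
  by_contra! hlt
  suffices hzero : homogeneousComponent m.degree q = 0 by
    have hcoeff := coeff_homogeneousComponent m.degree q m
    rw [hzero, if_pos rfl, coeff_zero] at hcoeff
    exact mem_support_iff.1 hm hcoeff.symm
  refine funext fun w => ?_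
  have hdeg : (restrictToLine 0 w q).natDegree ≤ d :=
    natDegree_le_of_eval_sq_le (P := restrictToLine 0 w P)
      (fun t => by simpa only [eval_restrictToLine, aeval_eq_eval] using h _)
      ((natDegree_restrictToLine_zero_le w P).trans hP)
  rw [map_zero, ← aeval_eq_eval, ← coeff_restrictToLine_zero]
  exact Polynomial.coeff_eq_zero_of_natDegree_lt (hdeg.trans_lt hlt)

theorem exists_le_restrictTotalDegree {R : Type*} [CommRing R]
    {F : Submodule R (MvPolynomial σ R)} (hF : F.FG) : ∃ N, F ≤ restrictTotalDegree σ R N := by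
  obtain ⟨S, rfl⟩ := hF
  exact ⟨S.sup totalDegree, Submodule.span_le.2 fun p hp =>
    (mem_restrictTotalDegree σ _ p).2 (Finset.le_sup hp)⟩

theorem hasStableSumsOfSquares_mvPolynomial [Finite σ] :
    HasStableSumsOfSquares (MvPolynomial σ ℝ) := by
  intro F hF
  obtain ⟨N, hN⟩ := exists_le_restrictTotalDegree (Module.Finite.iff_fg.1 hF)
  refine ⟨restrictTotalDegree σ ℝ N, inferInstance, fun q s hs hq => ?_⟩
  have hdeg : (q * q + s).totalDegree ≤ N := (mem_restrictTotalDegree σ N _).1 (hN hq)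
  exact (mem_restrictTotalDegree σ N q).2 <|
    totalDegree_le_of_eval_sq_le (eval_sq_le_eval_mul_self_add q hs) (by omega)

end RealPolynomials

theorem exists_nat_span_range_eq_top_of_finiteType (R B : Type*) [CommRing R] [CommRing B]
    [Algebra R B] [Algebra.FiniteType R B] :
    ∃ e : ℕ → B, Submodule.span R (Set.range e) = ⊤ := by
  obtain ⟨m, φ, hφ⟩ := Algebra.FiniteType.iff_quotient_mvPolynomial''.1
    (inferInstance : Algebra.FiniteType R B)
  obtain ⟨d, hd⟩ := exists_surjective_nat (Fin m →₀ ℕ)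
  refine ⟨φ ∘ MvPolynomial.basisMonomials (Fin m) R ∘ d, ?_⟩
  rw [Set.range_comp, hd.range_comp, ← φ.coe_toLinearMap, Submodule.span_image,
    Module.Basis.span_eq, Submodule.map_top, LinearMap.range_eq_top]
  exact hφ

/-- A real element: one whose square divides a sum of squares only if the element itself divides
every term, so that its square can be cancelled from sums of squares. -/
def IsRealElement {R : Type*} [CommRing R] (h : R) : Prop :=
  ∀ q s : R, IsSumSq s → h * h ∣ q * q + s → h ∣ q

namespace IsRealElement

variable {R : Type*} [CommRing R]

theorem exists_isSumSq_eq_mul {h s : R} (hh : IsRealElement h) (hs : IsSumSq s)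
    (hdvd : h * h ∣ s) : ∃ u, IsSumSq u ∧ s = h * h * u := by
  induction hs with
  | zero => exact ⟨0, .zero, (mul_zero _).symm⟩
  | @sq_add a s hs ih =>
    obtain ⟨c, rfl⟩ := hh a s hs hdvd
    obtain ⟨u, hu, rfl⟩ := ih ((dvd_add_right ⟨c * c, by ring⟩).1 hdvd)
    exact ⟨c * c + u, .sq_add c hu, by ring⟩

theorem one : IsRealElement (1 : R) := fun q _ _ _ => one_dvd q

variable [IsDomain R]

theorem mul {a b : R} (ha : IsRealElement a) (hb : IsRealElement b) :
    IsRealElement (a * b) := by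
  intro q s hs hdvd
  rw [mul_mul_mul_comm] at hdvd
  have haa : a * a ∣ q * q + s := dvd_of_mul_right_dvd hdvd
  obtain ⟨c, rfl⟩ := ha q s hs haa
  obtain ⟨u, hu, rfl⟩ := ha.exists_isSumSq_eq_mul hs ((dvd_add_right ⟨c * c, by ring⟩).1 haa)
  rcases eq_or_ne a 0 with rfl | ha0
  · simp only [zero_mul, dvd_refl]
  · rw [mul_mul_mul_comm a c, ← mul_add, mul_dvd_mul_iff_left (mul_ne_zero ha0 ha0)] at hdvd
    exact mul_dvd_mul_left a (hb c u hu hdvd)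

theorem pow {h : R} (hh : IsRealElement h) (k : ℕ) : IsRealElement (h ^ k) := by
  induction k with
  | zero => rw [pow_zero]; exact one
  | succ k ih => rw [pow_succ]; exact ih.mul hh

end IsRealElement

theorem finiteDimensional_comap {K V W : Type*} [DivisionRing K] [AddCommGroup V] [Module K V]
    [AddCommGroup W] [Module K W] {f : V →ₗ[K] W} (hf : Function.Injective f)
    (F : Submodule K W) [FiniteDimensional K F] : FiniteDimensional K (F.comap f) :=
  .of_injective (f.submoduleComap F) fun _ _ h => Subtype.ext (hf (congrArg Subtype.val h))

section Localization

variable {R : Type*} [CommRing R] {M : Submonoid R} {A : Type*} [CommRing A] [Algebra R A]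
  [IsLocalization M A]

variable (M) in
theorem exists_isSumSq_algebraMap_eq {s : A} (hs : IsSumSq s) :
    ∃ g ∈ M, ∃ u, IsSumSq u ∧ algebraMap R A u = algebraMap R A (g * g) * s := by
  induction hs with
  | zero => exact ⟨1, M.one_mem, 0, .zero, by simp⟩
  | sq_add a _ ih =>
    obtain ⟨g, hg, u, hu, hgu⟩ := ih
    obtain ⟨⟨b, k, hk⟩, hb⟩ := IsLocalization.surj M a
    refine ⟨g * k, M.mul_mem hg hk, g * b * (g * b) + k * k * u,
      .sq_add _ ((IsSumSq.mul_self k).mul hu), ?_⟩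
    simp only [map_add, map_mul, hgu, ← hb]
    ring

variable (hM : ∀ g ∈ M, IsRealElement g) (hM₀ : M ≤ nonZeroDivisors R)

include hM hM₀ in
theorem exists_eq_mul_self_add_of_algebraMap_eq {P : R} {a s : A} (hs : IsSumSq s)
    (hP : algebraMap R A P = a * a + s) :
    ∃ r u, IsSumSq u ∧ P = r * r + u ∧ algebraMap R A r = a := by
  obtain ⟨⟨b, k, hk⟩, hb⟩ := IsLocalization.surj M a
  obtain ⟨g, hg, t, ht, hgt⟩ := exists_isSumSq_algebraMap_eq M hs
  have hmem : g * k ∈ M := M.mul_mem hg hk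
  have hnum : g * k * (g * k) * P = g * b * (g * b) + k * k * t := by
    apply IsLocalization.injective A hM₀
    simp only [map_add, map_mul, hgt, hP, ← hb]
    ring
  have hreal := hM _ hmem
  have hkt : IsSumSq (k * k * t) := (IsSumSq.mul_self k).mul ht
  obtain ⟨r, hr⟩ := hreal _ _ hkt ⟨P, hnum.symm⟩
  rw [hr] at hnum
  obtain ⟨u, hu, hru⟩ := hreal.exists_isSumSq_eq_mul hkt
    ((dvd_add_right ⟨r * r, by ring⟩).1 ⟨P, hnum.symm⟩)
  have hcancel := mul_mem (hM₀ hmem) (hM₀ hmem)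
  refine ⟨r, u, hu, ?_, ?_⟩
  · rw [← mul_cancel_left_mem_nonZeroDivisors hcancel, hnum, hru]
    ring
  · apply (IsLocalization.map_units A ⟨_, hmem⟩).mul_left_cancel
    rw [← map_mul, ← hr, map_mul, ← hb, map_mul]
    ring

include hM hM₀ in
theorem isSumSq_of_isSumSq_algebraMap {P : R} (hP : IsSumSq (algebraMap R A P)) :
    IsSumSq P := by
  obtain ⟨r, u, hu, rfl, -⟩ :=
    exists_eq_mul_self_add_of_algebraMap_eq (P := P) hM hM₀ (a := 0) hP (by simp)
  exact .sq_add r hu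

variable (A) in
include hM hM₀ in
theorem isFormallyReal_of_isLocalization [IsFormallyReal R] : IsFormallyReal A :=
  .of_eq_zero_of_eq_zero_of_mul_self_add fun {s a} hs h => by
    obtain ⟨r, u, hu, hru, rfl⟩ :=
      exists_eq_mul_self_add_of_algebraMap_eq (P := 0) hM hM₀ hs (by rw [map_zero, h])
    have hrr : r * r = 0 := IsFormallyReal.eq_zero_of_add_right (.mul_self r) hu hru.symm
    rw [← sq, pow_eq_zero_iff two_ne_zero] at hrr
    rw [hrr, map_zero]

variable (M) in
theorem exists_mem_forall_algebraMap_mul_mem_range {k : Type*} [CommSemiring k] [Algebra k R]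
    [Algebra k A] [IsScalarTower k R A] {F : Submodule k A} (hF : F.FG) :
    ∃ g ∈ M, ∀ f ∈ F, ∃ P, algebraMap R A P = algebraMap R A g * f := by
  obtain ⟨S, rfl⟩ := hF
  obtain ⟨⟨g, hg⟩, hS⟩ := IsLocalization.exist_integer_multiples_of_finset M S
  let numerators : Submodule k A := (IsScalarTower.toAlgHom k R A).toLinearMap.range.comap
    (LinearMap.mulLeft k (algebraMap R A g))
  suffices Submodule.span k S ≤ numerators from ⟨g, hg, fun f hf => this hf⟩
  refine Submodule.span_le.2 fun f hf => ?_
  obtain ⟨P, hP⟩ := hS f hf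
  exact ⟨P, hP.trans (Algebra.smul_def g f)⟩

variable [Algebra ℝ R] [Algebra ℝ A] [IsScalarTower ℝ R A]

variable (A) in
include hM hM₀ in
theorem HasStableSumsOfSquares.of_isLocalization (hR : HasStableSumsOfSquares R) :
    HasStableSumsOfSquares A := by
  intro F hF
  obtain ⟨g, hg, hgF⟩ := exists_mem_forall_algebraMap_mul_mem_range M (Module.Finite.iff_fg.1 hF)
  let ι : R →ₗ[ℝ] A := (IsScalarTower.toAlgHom ℝ R A).toLinearMap
  let mulG : A →ₗ[ℝ] A := LinearMap.mulLeft ℝ (algebraMap R A g)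
  have hι : Function.Injective ι := IsLocalization.injective A hM₀
  have hmulG : Function.Injective mulG :=
    (IsLocalization.map_units A (⟨g, hg⟩ : M)).mul_right_injective
  obtain ⟨W, hW, hFW⟩ := hR ((F.map (mulG ∘ₗ mulG)).comap ι) (finiteDimensional_comap hι _)
  refine ⟨(W.map ι).comap mulG, finiteDimensional_comap hmulG _, fun a s hs has => ?_⟩
  obtain ⟨P, hP⟩ := hgF _ has
  have hgP : algebraMap R A (g * P) = mulG a * mulG a + algebraMap R A (g * g) * s := by
    simp only [map_mul, hP, mulG, LinearMap.mulLeft_apply]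
    ring
  obtain ⟨r, u, hu, hru, hr⟩ := exists_eq_mul_self_add_of_algebraMap_eq hM hM₀
    (((map_mul (algebraMap R A) g g).symm ▸ IsSumSq.mul_self _).mul hs) hgP
  refine ⟨r, hFW r u hu ?_, hr⟩
  rw [← hru]
  exact ⟨_, has, by simp [ι, mulG, hP]⟩

end Localization

section RealIrreducible

open MvPolynomial

theorem exists_C_mem_span_pair_of_not_dvd {S : Type*} [CommRing S] [IsDomain S]
    [UniqueFactorizationMonoid S] {P Q : Polynomial S} (hP : Irreducible P)
    (hdeg : P.natDegree ≠ 0) (h : ¬P ∣ Q) :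
    ∃ d ≠ 0, Polynomial.C d ∈ Ideal.span {P, Q} := by
  classical
  let : NormalizedGCDMonoid S := Classical.choice inferInstance
  let K := FractionRing S
  have hprim : P.IsPrimitive := hP.isPrimitive hdeg
  have hirr : Irreducible (P.map (algebraMap S K)) :=
    hprim.irreducible_iff_irreducible_map_fraction_map.1 hP
  obtain ⟨a, b, hab⟩ := hirr.coprime_iff_not_dvd.2 fun hdvd =>
    h (hprim.dvd_of_fraction_map_dvd_fraction_map hdvd)
  have clear_denominators (f : Polynomial K) : ∃ c ≠ 0, ∃ F : Polynomial S,
      F.map (algebraMap S K) = Polynomial.C (algebraMap S K c) * f := by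
    obtain ⟨c, hc, hF⟩ := IsLocalization.integerNormalization_spec (nonZeroDivisors S) f
    exact ⟨c, nonZeroDivisors.ne_zero hc, _, by rw [hF, Algebra.smul_def]; rfl⟩
  obtain ⟨c, hc, A, hA⟩ := clear_denominators a
  obtain ⟨e, he, B, hB⟩ := clear_denominators b
  refine ⟨c * e, mul_ne_zero hc he, Ideal.mem_span_pair.2
    ⟨Polynomial.C e * A, Polynomial.C c * B,
      Polynomial.map_injective _ (FaithfulSMul.algebraMap_injective S K) ?_⟩⟩
  simp only [Polynomial.map_add, Polynomial.map_mul, Polynomial.map_C, hA, hB, map_mul]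
  linear_combination Polynomial.C (algebraMap S K c) * Polynomial.C (algebraMap S K e) * hab

section Shear

variable {σ R : Type*} [CommRing R]

/-- The shear `xᵢ ↦ xᵢ + wᵢ t` of `R[x][t]`, fixing `t`. On polynomials in `x` alone it is the
restriction to the line in direction `w` through the generic point. -/
noncomputable def shear (w : σ → R) :
    Polynomial (MvPolynomial σ R) →ₐ[R] Polynomial (MvPolynomial σ R) :=
  Polynomial.eval₂AlgHom (restrictToLine X (C ∘ w)) Polynomial.X fun _ => .all _ _

theorem shear_comp_shear_neg (w : σ → R) : (shear w).comp (shear (-w)) = AlgHom.id R _ := by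
  ext <;> simp [shear, restrictToLine]

theorem shear_C (w : σ → R) (q : MvPolynomial σ R) :
    shear w (Polynomial.C q) = restrictToLine X (C ∘ w) q := by
  simp [shear]

theorem prime_restrictToLine_X [IsDomain R] (w : σ → R) {p : MvPolynomial σ R} (hp : Prime p) :
    Prime (restrictToLine X (C ∘ w) p) := by
  let e := AlgEquiv.ofAlgHom (shear w) (shear (-w)) (shear_comp_shear_neg w)
    (by simpa using shear_comp_shear_neg (-w))
  rw [← shear_C]
  exact (MulEquiv.prime_iff e).2 (Polynomial.prime_C_iff.2 hp)

theorem eval₂_eval_restrictToLine_X (w x : σ → R) (t : R) (q : MvPolynomial σ R) :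
    (restrictToLine X (C ∘ w) q).eval₂ (eval x) t = eval (x + t • w) q := by
  have hline := eval₂_restrictToLine X (C ∘ w) (aeval x) t q
  simpa [Pi.add_def, Pi.smul_def, mul_comm] using hline

theorem eval_zero_restrictToLine_X (w : σ → R) (q : MvPolynomial σ R) :
    (restrictToLine X (C ∘ w) q).eval 0 = q := by
  simp [eval_restrictToLine]

end Shear

theorem eq_zero_of_eventually_eval_eq_zero {σ : Type*} [Finite σ] {d : MvPolynomial σ ℝ}
    {u : σ → ℝ} (hd : ∀ᶠ x in 𝓝 u, eval x d = 0) : d = 0 := by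
  cases nonempty_fintype σ
  obtain ⟨ε, hε, hball⟩ := Metric.eventually_nhds_iff_ball.1 hd
  refine funext_set (fun i => Metric.ball (u i) ε) (fun i => ?_) fun x hx => ?_
  · rw [Real.ball_eq_Ioo]
    exact Set.Ioo_infinite (by linarith)
  · rw [map_zero]
    refine hball x ?_
    rwa [ball_pi _ hε]

theorem eventually_exists_eq_zero_of_neg_of_pos {E : Type*} [AddCommGroup E] [Module ℝ E]
    [TopologicalSpace E] [IsTopologicalAddGroup E] [ContinuousSMul ℝ E] {f : E → ℝ}
    (hf : Continuous f) {u v : E} (hu : f u < 0) (hv : 0 < f v) :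
    ∀ᶠ x in 𝓝 u, ∃ t : ℝ, f (x + t • (v - u)) = 0 := by
  have hend : Continuous fun x => f (x + (1 : ℝ) • (v - u)) := by fun_prop
  filter_upwards [hf.continuousAt.eventually_lt_const hu,
    hend.continuousAt.eventually_const_lt (by simpa using hv)] with x hx hx'
  have hline : Continuous fun t : ℝ => f (x + t • (v - u)) := by fun_prop
  obtain ⟨t, -, ht⟩ := intermediate_value_Icc zero_le_one hline.continuousOn
    ⟨by simpa using hx.le, hx'.le⟩
  exact ⟨t, ht⟩

namespace IsRealIrreducible

variable {n : ℕ} {p q : MvPolynomial (Fin n) ℝ}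

theorem dvd_of_eval_eq_zero (hp : IsRealIrreducible p) (hq : ∀ x, eval x p = 0 → eval x q = 0) :
    p ∣ q := by
  obtain ⟨hirr, u, v, hu, hv⟩ := hp
  let w : Fin n → ℝ := v - u
  have hdeg : (restrictToLine X (C ∘ w) p).natDegree ≠ 0 := fun h0 => by
    have hu' := eval₂_eval_restrictToLine_X w u 0 p
    have hv' := eval₂_eval_restrictToLine_X w u 1 p
    rw [Polynomial.eq_C_of_natDegree_eq_zero h0, Polynomial.eval₂_C] at hu' hv'
    rw [hu', zero_smul, add_zero, one_smul, add_sub_cancel] at hv'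
    exact (hu.trans hv).ne hv'
  by_contra hpq
  have hndvd : ¬restrictToLine X (C ∘ w) p ∣ restrictToLine X (C ∘ w) q := fun hdvd => hpq <| by
    simpa only [Polynomial.coe_evalRingHom, eval_zero_restrictToLine_X] using
      map_dvd (Polynomial.evalRingHom 0) hdvd
  obtain ⟨d, hd, hspan⟩ := exists_C_mem_span_pair_of_not_dvd
    (prime_restrictToLine_X w hirr.prime).irreducible hdeg hndvd
  obtain ⟨a, b, hab⟩ := Ideal.mem_span_pair.1 hspan
  refine hd (eq_zero_of_eventually_eval_eq_zero (u := u) ?_)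
  filter_upwards [eventually_exists_eq_zero_of_neg_of_pos (continuous_eval p) hu hv]
    with x ⟨t, ht⟩
  have heval := congrArg (Polynomial.eval₂ (eval x) t) hab
  rw [Polynomial.eval₂_add, Polynomial.eval₂_mul, Polynomial.eval₂_mul,
    eval₂_eval_restrictToLine_X, eval₂_eval_restrictToLine_X, Polynomial.eval₂_C, ht, hq _ ht,
    mul_zero, mul_zero, add_zero] at heval
  exact heval.symm

theorem isRealElement (hp : IsRealIrreducible p) : IsRealElement p := by
  rintro q s hs ⟨c, hc⟩
  refine hp.dvd_of_eval_eq_zero fun x hx => ?_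
  have hle := eval_sq_le_eval_mul_self_add q hs x
  rw [hc, map_mul, map_mul, hx, zero_mul, zero_mul] at hle
  exact sq_nonpos_iff _ |>.1 hle

theorem isRealElement_multiset_prod {s : Multiset (MvPolynomial (Fin n) ℝ)}
    (hs : ∀ p ∈ s, IsRealIrreducible p) : IsRealElement s.prod :=
  Multiset.prod_induction _ s (fun _ _ => .mul) .one fun p hp => (hs p hp).isRealElement

end IsRealIrreducible

end RealIrreducible

theorem isClosed_sosCone_of_isLocalization {σ : Type*} [Finite σ]
    {M : Submonoid (MvPolynomial σ ℝ)} (hM : ∀ g ∈ M, IsRealElement g)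
    (hM₀ : M ≤ nonZeroDivisors (MvPolynomial σ ℝ)) (A : Type*) [CommRing A]
    [Algebra (MvPolynomial σ ℝ) A] [IsLocalization M A] [Algebra ℝ A]
    [IsScalarTower ℝ (MvPolynomial σ ℝ) A] [Algebra.FiniteType ℝ A] :
    IsClosed[finestLocallyConvexTopology A] (sosCone A) := by
  have := isFormallyReal_of_isLocalization A hM hM₀
  obtain ⟨e, he⟩ := exists_nat_span_range_eq_top_of_finiteType ℝ A
  exact (hasStableSumsOfSquares_mvPolynomial.of_isLocalization A hM hM₀).isClosed_sosCone he

section Motzkin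

open Polynomial

/-- The Motzkin polynomial as an element of `ℝ[X][Y]`. -/
noncomputable def bivariateMotzkin : ℝ[X][X] :=
  C (X ^ 4) * X ^ 2 + C (X ^ 2) * X ^ 4 - C (C 3 * X ^ 2) * X ^ 2 + 1

theorem coeff_bivariateMotzkin (k : ℕ) :
    bivariateMotzkin.coeff k = (if k = 2 then X ^ 4 else 0) + (if k = 4 then X ^ 2 else 0) -
      (if k = 2 then C 3 * X ^ 2 else 0) + if k = 0 then 1 else 0 := by
  simp only [bivariateMotzkin, coeff_add, coeff_sub, coeff_C_mul, coeff_X_pow, coeff_one, mul_ite,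
    mul_one, mul_zero]

theorem natDegree_bivariateMotzkin_le : bivariateMotzkin.natDegree ≤ 4 := by
  unfold bivariateMotzkin
  compute_degree

theorem evalEval_bivariateMotzkin (a b : ℝ) : bivariateMotzkin.evalEval a b =
    a ^ 4 * b ^ 2 + a ^ 2 * b ^ 4 - 3 * a ^ 2 * b ^ 2 + 1 := by
  simp [bivariateMotzkin, evalEval]

section Dominated

variable {F : ℝ[X][X]} (hF : ∀ a b, F.evalEval a b ^ 2 ≤ bivariateMotzkin.evalEval a b)

include hF

theorem coeff_coeff_zero_of_evalEval_sq_le_motzkin {k : ℕ} (hk : k ≠ 0) :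
    (F.coeff 0).coeff k = 0 := by
  have hle (a : ℝ) : (F.coeff 0).eval a ^ 2 ≤ (1 : ℝ[X]).eval a := by
    have hFa := hF a 0
    rw [evalEval_bivariateMotzkin, evalEval, C_0, ← coeff_zero_eq_eval_zero] at hFa
    simpa using hFa
  have hdeg := natDegree_le_of_eval_sq_le (d := 0) hle (by simp)
  exact coeff_eq_zero_of_natDegree_lt (by omega)

theorem coeff_one_coeff_zero_of_evalEval_sq_le_motzkin : (F.coeff 1).coeff 0 = 0 := by
  have hdeg : (F.map (evalRingHom 0)).natDegree ≤ 0 :=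
    natDegree_le_of_eval_sq_le (P := 1)
      (fun b => by simpa [evalEval_bivariateMotzkin, map_evalRingHom_eval] using hF 0 b)
      (by simp)
  rw [coeff_zero_eq_eval_zero, ← coe_evalRingHom, ← coeff_map]
  exact coeff_eq_zero_of_natDegree_lt (by omega)

theorem coeff_two_coeff_two_of_evalEval_sq_le_motzkin : (F.coeff 2).coeff 2 = 0 := by
  have hlead (a : ℝ) : (F.coeff 2).eval a ^ 2 ≤ (X ^ 2 : ℝ[X]).eval a := by
    have hcoeff := coeff_sq_le_of_eval_sq_le (d := 2) (Q := F.map (evalRingHom a))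
      (P := bivariateMotzkin.map (evalRingHom a))
      (fun b => by simpa only [map_evalRingHom_eval] using hF a b)
      (natDegree_map_le.trans natDegree_bivariateMotzkin_le)
    simpa [coeff_bivariateMotzkin] using hcoeff
  have hdeg := natDegree_le_of_eval_sq_le (d := 1) hlead (by simp)
  exact coeff_eq_zero_of_natDegree_lt (by omega)

theorem coeff_two_coeff_two_mul_self_nonneg_of_evalEval_sq_le_motzkin :
    0 ≤ ((F * F).coeff 2).coeff 2 := by
  have hF₀ {k : ℕ} (hk : k ≠ 0) := coeff_coeff_zero_of_evalEval_sq_le_motzkin hF hk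
  have hF₁ := coeff_one_coeff_zero_of_evalEval_sq_le_motzkin hF
  have hF₂ := coeff_two_coeff_two_of_evalEval_sq_le_motzkin hF
  have hsq : ((F * F).coeff 2).coeff 2 = (F.coeff 1).coeff 1 ^ 2 := by
    simp [coeff_mul, Finset.Nat.antidiagonal_succ, hF₀, hF₁, hF₂, sq]
  rw [hsq]
  exact sq_nonneg _

end Dominated

theorem not_isSumSq_bivariateMotzkin : ¬IsSumSq bivariateMotzkin := by
  have key {s : ℝ[X][X]} (hs : IsSumSq s)
      (hle : ∀ a b, s.evalEval a b ≤ bivariateMotzkin.evalEval a b) :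
      0 ≤ (s.coeff 2).coeff 2 := by
    induction hs with
    | zero => simp
    | @sq_add F s hs ih =>
      have hs₀ (a b : ℝ) : 0 ≤ s.evalEval a b :=
        (isSumSq_map (evalEvalRingHom a b) hs).nonneg
      simp only [evalEval_add, evalEval_mul] at hle
      rw [coeff_add, coeff_add]
      refine add_nonneg ?_ (ih fun a b => ?_)
      · refine coeff_two_coeff_two_mul_self_nonneg_of_evalEval_sq_le_motzkin fun a b => ?_
        linarith [hle a b, hs₀ a b]
      · linarith [hle a b, mul_self_nonneg (F.evalEval a b)]
  intro hsos
  have hcoeff : (bivariateMotzkin.coeff 2).coeff 2 = -3 := by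
    norm_num [coeff_bivariateMotzkin, coeff_X_pow]
  linarith [key hsos fun _ _ => le_rfl]

variable {n : ℕ}

theorem not_isSumSq_motzkinPolynomial {i j : Fin n} (hij : i ≠ j) :
    ¬IsSumSq (motzkinPolynomial i j) := by
  let φ : MvPolynomial (Fin n) ℝ →ₐ[ℝ] ℝ[X][X] :=
    MvPolynomial.aeval fun k => if k = i then C X else if k = j then X else 0
  have hφ : φ (motzkinPolynomial i j) = bivariateMotzkin := by
    have h3 : C (C (3 : ℝ)) = 3 := by rw [map_ofNat, map_ofNat]
    simp [φ, motzkinPolynomial, bivariateMotzkin, hij.symm, h3]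
  exact fun h => not_isSumSq_bivariateMotzkin (hφ ▸ isSumSq_map φ h)

theorem motzkin_nonneg (a b : ℝ) :
    0 ≤ a ^ 4 * b ^ 2 + a ^ 2 * b ^ 4 - 3 * a ^ 2 * b ^ 2 + 1 := by
  have hab : 0 ≤ a ^ 2 * b ^ 2 := by positivity
  rcases le_total 3 (a ^ 2 + b ^ 2) with h | h
  · nlinarith [mul_nonneg hab (sub_nonneg.2 h)]
  · have h1 : 0 ≤ (a ^ 2 + b ^ 2 - 2) ^ 2 * (a ^ 2 + b ^ 2 + 1) := by positivity
    have h2 := mul_nonneg (sub_nonneg.2 h) (sq_nonneg (a ^ 2 - b ^ 2))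
    linarith

theorem algebraMap_motzkinPolynomial_mem_psdCone (B : Type*) [CommRing B] [Algebra ℝ B]
    [Algebra (MvPolynomial (Fin n) ℝ) B] [IsScalarTower ℝ (MvPolynomial (Fin n) ℝ) B]
    (i j : Fin n) : algebraMap (MvPolynomial (Fin n) ℝ) B (motzkinPolynomial i j) ∈ psdCone B := by
  intro χ
  let ψ := (show B →ₐ[ℝ] ℝ from χ).comp (IsScalarTower.toAlgHom ℝ (MvPolynomial (Fin n) ℝ) B)
  have hψ : ψ (motzkinPolynomial i j) = ψ (.X i) ^ 4 * ψ (.X j) ^ 2 + ψ (.X i) ^ 2 * ψ (.X j) ^ 4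
      - 3 * ψ (.X i) ^ 2 * ψ (.X j) ^ 2 + 1 := by
    simp only [motzkinPolynomial, map_add, map_sub, map_mul, map_pow, map_ofNat, map_one]
  exact (motzkin_nonneg _ _).trans_eq hψ.symm

end Motzkin

theorem not_hasMomentProperty_of_isClosed {B : Type*} [CommRing B] [Algebra ℝ B]
    (hcl : IsClosed[finestLocallyConvexTopology B] (sosCone B)) {f : B} (hf : f ∈ psdCone B)
    (hf' : f ∉ sosCone B) : ¬HasMomentProperty B := by
  intro hmom
  let : TopologicalSpace B := finestLocallyConvexTopology B
  have := finestLocallyConvexTopology.isTopologicalAddGroup B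
  have := finestLocallyConvexTopology.continuousSMul B
  have := finestLocallyConvexTopology.locallyConvexSpace B
  let sos : ProperCone ℝ B :=
    { carrier := sosCone B
      add_mem' := IsSumSq.add
      zero_mem' := .zero
      smul_mem' := fun r _ => isSumSq_smul r.2
      isClosed' := hcl }
  obtain ⟨L, hL, hLf⟩ := sos.hyperplane_separation_point hf'
  obtain ⟨μ, -, -, hμ⟩ := hmom L.toLinearMap fun g => hL _ (by rw [sq]; exact .mul_self g)
  have hint : L f = ∫ χ : RealCharacter B, χ f ∂μ := (hμ f).2
  have hnonneg : 0 ≤ ∫ χ : RealCharacter B, χ f ∂μ :=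
    MeasureTheory.integral_nonneg fun χ => hf χ
  linarith

theorem mainTheorem3 (n : ℕ) (h : MvPolynomial (Fin n) ℝ)
    (hh : ∃ s : Multiset (MvPolynomial (Fin n) ℝ),
      (∀ p ∈ s, IsRealIrreducible p) ∧ h = s.prod) :
    IsClosed[finestLocallyConvexTopology (FractionAlgebra h)] (sosCone (FractionAlgebra h)) ∧
    (2 ≤ n →
      ¬ HasMomentProperty (FractionAlgebra h) ∧
      ∀ i j : Fin n, i ≠ j →
        algebraMap (MvPolynomial (Fin n) ℝ) (FractionAlgebra h) (motzkinPolynomial i j)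
            ∈ psdCone (FractionAlgebra h) ∧
        algebraMap (MvPolynomial (Fin n) ℝ) (FractionAlgebra h) (motzkinPolynomial i j)
            ∉ sosCone (FractionAlgebra h)) := by
  obtain ⟨s, hs, rfl⟩ := hh
  have hM : ∀ g ∈ Submonoid.powers s.prod, IsRealElement g := by
    rintro _ ⟨k, rfl⟩
    exact (IsRealIrreducible.isRealElement_multiset_prod hs).pow k
  have hM₀ : Submonoid.powers s.prod ≤ nonZeroDivisors (MvPolynomial (Fin n) ℝ) :=
    powers_le_nonZeroDivisors_of_noZeroDivisors
      (Multiset.prod_ne_zero fun h0 => (hs 0 h0).1.ne_zero rfl)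
  let A := FractionAlgebra s.prod
  have := IsLocalization.finiteType_of_monoid_fg (Submonoid.powers s.prod) A
  have := Algebra.FiniteType.trans (R := ℝ) (S := MvPolynomial (Fin n) ℝ) (A := A)
    inferInstance inferInstance
  have hclosed := isClosed_sosCone_of_isLocalization hM hM₀ A
  have hpsd := algebraMap_motzkinPolynomial_mem_psdCone (n := n) A
  have hsos {i j : Fin n} (hij : i ≠ j) :
      algebraMap (MvPolynomial (Fin n) ℝ) A (motzkinPolynomial i j) ∉ sosCone A := fun h =>
    not_isSumSq_motzkinPolynomial hij (isSumSq_of_isSumSq_algebraMap hM hM₀ h)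
  refine ⟨hclosed, fun hn => ⟨?_, fun i j hij => ⟨hpsd i j, hsos hij⟩⟩⟩
  have h01 : (⟨0, by omega⟩ : Fin n) ≠ ⟨1, by omega⟩ := by simp
  exact not_hasMomentProperty_of_isClosed hclosed (hpsd _ _) (hsos h01)
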